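/- Let $n\ge 0$ be an integer and let $B=\{x\in\mathbb R^3: x_1+x_2+x_3=0\}$. Let $d_1=(0,1,-1)$ ("northwest"), $d_2=(-1,0,1)$ ("northeast"), $d_3=(1,-1,0)$ ("south"). Put $U_n=\{p\in\mathbb Z_{\ge0}^3:p_1+p_2+p_3=n-1\}$ and $D_n=\{q\in\mathbb Z_{\ge0}^3:q_1+q_2+q_3=n-2\}$ (the upright and upside-down unit triangles of a lattice triangle of side length $n$; $p_1,p_2,p_3$ are the distances to the northwest, northeast and south sides). A (possibly degenerate) $n$-honeycomb is a placement $u_p\in B$ $(p\in U_n)$, $w_q\in B$ $(q\in D_n)$ of vertices such that $w_q-u_{q+e_k}$ is a nonnegative multiple of $d_k$ for all $q\in D_n$ and $k=1,2,3$. For each $p\in U_n$ with $p_k=0$ a semi-infinite edge in direction $d_k$ leaves $u_p$; its constant coordinate is the $k$-th coordinate of $u_p$. The boundary of the honeycomb is the triple $(\lambda,\mu,\nu)\in(\mathbb R^n)^3$ of the constant coordinates of the semi-infinite edges in direction $d_1$, $d_2$, $d_3$ respectively, each side read clockwise; that is, for $1\le i\le n$, $\lambda_i$, $\mu_i$, $\nu_i$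 are the constant coordinates on the edges at $p=(0,n-i,i-1)$, $(i-1,0,n-i)$, $(n-i,i-1,0)$ respectively. Let $\mathrm{LR}_n\subseteq(\mathbb R^n)^3$ be the set of boundaries of all $n$-honeycombs. It is a convex polyhedral cone. (Equivalently, it is the set of triples of weakly decreasing spectra of three $n\times n$ Hermitian matrices with zero sum.) A facet of a polyhedron is a nonempty face of codimension one. A linear inequality $f\ge0$ valid on $\mathrm{LR}_n$ is called essential if $\mathrm{LR}_n\cap f^{-1}(0)$ is a facet of $\mathrm{LR}_n$. The chamber inequalities are $\lambda_i\ge\lambda_{i+1}$, $\mu_i\ge\mu_{i+1}$, $\nu_i\ge\nu_{i+1}$ for $1\le i<n$. A facet of $\mathrm{LR}_n$ is regular if it is not the set of points of $\mathrm{LR}_n$ at which some chamber inequality is an equality; a regular inequality is a linear inequality $f\ge0$ valid on $\mathrm{LR}_n$ for which $\mathrm{LR}_n\cap f^{-1}(0)$ is a regular facet. Theorem. For every $n>2$, each of the chamber inequalities is valid on $\mathrm{LR}_n$ and is essential. For $n=2$, every $(\lambda,\mu,\nu)\in(\mathbb R^2)^3$ that satisfies all the regular inequalities of $\mathrm{LR}_2$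 and the equality $\lambda_1+\lambda_2+\mu_1+\mu_2+\nu_1+\nu_2=0$ satisfies the chamber inequalities $\lambda_1\ge\lambda_2$, $\mu_1\ge\mu_2$, $\nu_1\ge\nu_2$. -/

import Mathlib

/-- The honeycomb tinkertoy is dual to the lattice triangle of side length `n`. Its vertices of the
first kind (a northwest, a northeast and a south edge) are the upright unit triangles; the entries
`p 0`, `p 1`, `p 2` are the lattice distances to the northwest, northeast and south sides. -/
def UpVertex (n : ℕ) : Type := {p : Fin 3 → ℕ // p 0 + p 1 + p 2 + 1 = n}

/-- The vertices of the second kind (a southeast, a southwest and a north edge) are the upside-down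
unit triangles. -/
def DownVertex (n : ℕ) : Type := {p : Fin 3 → ℕ // p 0 + p 1 + p 2 + 2 = n}

/-- The direction, in the plane `x 0 + x 1 + x 2 = 0`, of the edges with constant `k`-th coordinate
that leave a vertex of the first kind: `(0,1,-1)` is northwest, `(-1,0,1)` is northeast and
`(1,-1,0)` is south. -/
def edgeDir (k : Fin 3) : Fin 3 → ℝ := Pi.single (k + 1) 1 - Pi.single (k + 2) 1

/-- An `n`-honeycomb (a possibly degenerate configuration of the honeycomb tinkertoy): the vertices
are placed in the plane `x 0 + x 1 + x 2 = 0` so that every bounded edge is a nonnegative multiple of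
its prescribed direction. The upright triangle `u` and the upside-down triangle `d` share an edge
parallel to side `k` exactly when `u` is `d` with the `k`-th entry raised by one. -/
structure Honeycomb (n : ℕ) where
  up : UpVertex n → Fin 3 → ℝ
  down : DownVertex n → Fin 3 → ℝ
  up_sum : ∀ u, up u 0 + up u 1 + up u 2 = 0
  down_sum : ∀ d, down d 0 + down d 1 + down d 2 = 0
  edge : ∀ (k : Fin 3) (u : UpVertex n) (d : DownVertex n), u.1 = d.1 + Pi.single k 1 →
    ∃ t : ℝ, 0 ≤ t ∧ down d = up u + t • edgeDir k

/-- The vertex carrying the `i`-th semi-infinite edge on side `k`, counted clockwise from `0`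
(sides `0`, `1`, `2` are northwest, northeast and south). -/
def boundaryVertex {n : ℕ} (k : Fin 3) (i : Fin n) : UpVertex n :=
  ⟨Pi.single (k + 1) (n - 1 - (i : ℕ)) + Pi.single (k + 2) (i : ℕ), by
    have := i.isLt
    fin_cases k <;> simp <;> omega⟩

/-- The constant coordinates of the semi-infinite edges: `b 0`, `b 1`, `b 2` are `λ`, `μ`, `ν`. -/
def Honeycomb.boundary {n : ℕ} (h : Honeycomb n) : Fin 3 → Fin n → ℝ :=
  fun k i => h.up (boundaryVertex k i) k

/-- The cone of boundaries `(λ, μ, ν)` of `n`-honeycombs. -/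
def LR (n : ℕ) : Set (Fin 3 → Fin n → ℝ) := Set.range Honeycomb.boundary

/-- A facet of a convex polyhedron: a nonempty face of codimension one. -/
def IsFacet {E : Type*} [AddCommGroup E] [Module ℝ E] [TopologicalSpace E] (P F : Set E) : Prop :=
  F.Nonempty ∧ IsExposed ℝ P F ∧
    Module.finrank ℝ (vectorSpan ℝ F) + 1 = Module.finrank ℝ (vectorSpan ℝ P)

/-- The inequality `0 ≤ f` is valid on `P` and is attained with equality exactly on a facet. -/
def IsEssential {E : Type*} [AddCommGroup E] [Module ℝ E] [TopologicalSpace E]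
    (f : E →ₗ[ℝ] ℝ) (P : Set E) : Prop :=
  (∀ x ∈ P, 0 ≤ f x) ∧ IsFacet P {x ∈ P | f x = 0}

/-- The functional `(λ, μ, ν) ↦ λ_i - λ_j` (`k = 0`), `μ_i - μ_j` (`k = 1`), `ν_i - ν_j` (`k = 2`);
the chamber functionals are those with `j = i + 1`. -/
def chamber {n : ℕ} (k : Fin 3) (i j : Fin n) : (Fin 3 → Fin n → ℝ) →ₗ[ℝ] ℝ where
  toFun b := b k i - b k j
  map_add' b c := by simp only [Pi.add_apply]; ring
  map_smul' r b := by simp only [Pi.smul_apply, smul_eq_mul, RingHom.id_apply]; ring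

/-- A regular facet of `LR n`: a facet not cut out by any chamber inequality. -/
def IsRegularFacet (n : ℕ) (F : Set (Fin 3 → Fin n → ℝ)) : Prop :=
  IsFacet (LR n) F ∧
    ∀ (k : Fin 3) (i j : Fin n), (j : ℕ) = i + 1 → F ≠ {b ∈ LR n | chamber k i j b = 0}

/-- `0 ≤ f` is a regular inequality: it is valid on `LR n` and determines a regular facet. -/
def IsRegularInequality (n : ℕ) (f : (Fin 3 → Fin n → ℝ) →ₗ[ℝ] ℝ) : Prop :=
  (∀ b ∈ LR n, 0 ≤ f b) ∧ IsRegularFacet n {b ∈ LR n | f b = 0}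

/-! The difference of two consecutive boundary coordinates is the sum of the lengths of the two
edges at one upside-down triangle (`Honeycomb.chamber_boundary`). Hence chamber inequalities are
valid, and equality means that both edges collapse: seemingly two conditions on the honeycomb, which
must cost only one dimension on the boundary.

Honeycombs are deformed by adding slopes of a function on lattice points; each edge length changes
by a second difference across the dual lattice segment (`rhombus`). A convex function with unit
second differences, plus bumps at the boundary point common to the two dual segments, shrinks both
edges equally. A bump at an interior point shortens one and lengthens the other without moving the
boundary. Together they carry any honeycomb onto the face, and the boundary changes along a single
direction modulo the span of the face. An interior point exists exactly when `n > 2`.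

For `n = 2` the honeycomb is a star with three bounded edges, whose lengths are linear in the
boundary and are regular inequalities. Each chamber functional is a sum of two of them once the
total vanishes. -/

/-! ### A linear criterion for facets. -/

open Submodule in
theorem vectorSpan_eq_span_of_zero_mem {E : Type*} [AddCommGroup E] [Module ℝ E] {s : Set E}
    (h : (0 : E) ∈ s) : vectorSpan ℝ s = span ℝ s := by
  rw [vectorSpan_eq_span_vsub_set_right ℝ h]
  simp

/-- A linear functional that is nonnegative on `P` cuts out a facet as soon as, modulo the span of
its zero set in `P`, every point of `P` is a multiple of one point off that zero set. -/
theorem isEssential_of_forall_sub_smul_mem {E : Type*} [NormedAddCommGroup E] [NormedSpace ℝ E]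
    [FiniteDimensional ℝ E] {P : Set E} {f : E →ₗ[ℝ] ℝ} (hP : (0 : E) ∈ P)
    (hf : ∀ x ∈ P, 0 ≤ f x) {x₀ : E} (hx₀ : x₀ ∈ P) (hfx₀ : f x₀ ≠ 0)
    (h : ∀ x ∈ P, ∃ r : ℝ, x - r • x₀ ∈ Submodule.span ℝ {x ∈ P | f x = 0}) :
    IsEssential f P := by
  have h0 : (0 : E) ∈ {x ∈ P | f x = 0} := ⟨hP, map_zero f⟩
  -- Exposed faces are sets of maximizers, hence the sign. The maximum is zero because the origin
  -- lies in `P`.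
  refine ⟨hf, ⟨0, h0⟩, fun _ => ⟨-LinearMap.toContinuousLinearMap f, ?_⟩, ?_⟩
  · ext x
    simp only [Set.mem_ofPred_eq, neg_apply,
      LinearMap.coe_toContinuousLinearMap', neg_le_neg_iff]
    constructor
    · rintro ⟨hx, hx0⟩
      exact ⟨hx, fun y hy => hx0 ▸ hf y hy⟩
    · rintro ⟨hx, hx0⟩
      refine ⟨hx, le_antisymm ?_ (hf x hx)⟩
      simpa using hx0 0 hP
  · rw [vectorSpan_eq_span_of_zero_mem h0, vectorSpan_eq_span_of_zero_mem hP]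
    set S := Submodule.span ℝ {x ∈ P | f x = 0} with hS
    have hker : S ≤ LinearMap.ker f := Submodule.span_le.2 fun x hx => hx.2
    have hsup : Submodule.span ℝ P = S ⊔ Submodule.span ℝ {x₀} := by
      apply le_antisymm
      · refine Submodule.span_le.2 fun x hx => ?_
        obtain ⟨r, hr⟩ := h x hx
        exact Submodule.mem_sup.2 ⟨_, hr, r • x₀,
          Submodule.smul_mem _ _ (Submodule.mem_span_singleton_self _), sub_add_cancel _ _⟩
      · refine sup_le (Submodule.span_mono fun x hx => hx.1) (Submodule.span_mono ?_)
        simpa using hx₀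
    have hinf : S ⊓ Submodule.span ℝ {x₀} = ⊥ := by
      refine (Submodule.eq_bot_iff _).2 fun x ⟨hxS, hx⟩ => ?_
      obtain ⟨r, rfl⟩ := Submodule.mem_span_singleton.1 hx
      have hr : r * f x₀ = 0 := by simpa using hker hxS
      rw [(mul_eq_zero.1 hr).resolve_right hfx₀, zero_smul]
    have hx₀' : x₀ ≠ 0 := by
      rintro rfl
      exact hfx₀ (map_zero f)
    have hdim := Submodule.finrank_sup_add_finrank_inf_eq S (Submodule.span ℝ {x₀})
    rw [hinf, finrank_bot, finrank_span_singleton hx₀'] at hdim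
    rw [hsup, ← hdim, add_zero]

/-! ### Edges of a honeycomb and their lengths. -/

/-- The upright triangle that shares with `d` its edge parallel to side `k`. -/
def DownVertex.nbr {n : ℕ} (d : DownVertex n) (k : Fin 3) : UpVertex n :=
  ⟨d.1 + Pi.single k 1, by
    have := d.2
    fin_cases k <;> simp <;> omega⟩

@[simp]
theorem edgeDir_add_one (k : Fin 3) : edgeDir k (k + 1) = 1 := by
  fin_cases k <;> simp [edgeDir]

@[simp]
theorem edgeDir_add_two (k : Fin 3) : edgeDir k (k + 2) = -1 := by
  fin_cases k <;> simp [edgeDir]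

@[simp]
theorem edgeDir_self (k : Fin 3) : edgeDir k k = 0 := by
  fin_cases k <;> simp [edgeDir]

theorem add_one_add_one (k : Fin 3) : k + 1 + 1 = k + 2 := by revert k; decide

theorem add_one_add_two (k : Fin 3) : k + 1 + 2 = k := by revert k; decide

theorem add_two_add_one (k : Fin 3) : k + 2 + 1 = k := by revert k; decide

theorem add_two_add_two (k : Fin 3) : k + 2 + 2 = k + 1 := by revert k; decide

theorem ext_fin_three {α : Type*} {f g : Fin 3 → α} (k : Fin 3) (h₀ : f k = g k)
    (h₁ : f (k + 1) = g (k + 1)) (h₂ : f (k + 2) = g (k + 2)) : f = g := by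
  funext m
  have hm : ∀ m k : Fin 3, m = k ∨ m = k + 1 ∨ m = k + 2 := by decide
  obtain rfl | rfl | rfl := hm m k
  exacts [h₀, h₁, h₂]

namespace Honeycomb

variable {n : ℕ}

/-- The length of the edge at `d` that has constant `k`-th coordinate. -/
def length (h : Honeycomb n) (d : DownVertex n) (k : Fin 3) : ℝ :=
  h.down d (k + 1) - h.up (d.nbr k) (k + 1)

theorem length_nonneg_and_down_eq (h : Honeycomb n) (d : DownVertex n) (k : Fin 3) :
    0 ≤ h.length d k ∧ h.down d = h.up (d.nbr k) + h.length d k • edgeDir k := by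
  obtain ⟨t, ht, e⟩ := h.edge k (d.nbr k) d rfl
  have : h.length d k = t := by simp [length, e]
  rw [this]
  exact ⟨ht, e⟩

theorem length_nonneg (h : Honeycomb n) (d : DownVertex n) (k : Fin 3) : 0 ≤ h.length d k :=
  (h.length_nonneg_and_down_eq d k).1

theorem down_eq (h : Honeycomb n) (d : DownVertex n) (k : Fin 3) :
    h.down d = h.up (d.nbr k) + h.length d k • edgeDir k :=
  (h.length_nonneg_and_down_eq d k).2

/-- The completely degenerate honeycomb. -/
def zero (n : ℕ) : Honeycomb n where
  up _ := 0
  down _ := 0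
  up_sum := by simp
  down_sum := by simp
  edge _ _ _ _ := ⟨0, le_rfl, by simp⟩

@[simp]
theorem length_zero (d : DownVertex n) (k : Fin 3) : (zero n).length d k = 0 := by
  simp [length, zero]

@[simp]
theorem boundary_zero : (zero n).boundary = 0 := by
  ext
  simp [boundary, zero]

end Honeycomb

theorem zero_mem_LR (n : ℕ) : 0 ∈ LR n := ⟨Honeycomb.zero n, Honeycomb.boundary_zero⟩

/-! ### Deforming honeycombs by functions on lattice points. -/

/-- The second difference of `G` across the edge of the triangle `q` parallel to side `k`. -/
def rhombus (G : (Fin 3 → ℕ) → ℝ) (q : Fin 3 → ℕ) (k : Fin 3) : ℝ :=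
  G (q + (Pi.single (k + 1) 1 + Pi.single (k + 2) 1)) + G (q + (Pi.single k 1 + Pi.single k 1)) -
    G (q + (Pi.single k 1 + Pi.single (k + 1) 1)) - G (q + (Pi.single k 1 + Pi.single (k + 2) 1))

/-- The first differences of `G` along the sides of the lattice triangle. -/
def boundaryDiff (n : ℕ) (G : (Fin 3 → ℕ) → ℝ) : Fin 3 → Fin n → ℝ := fun k i =>
  G ((boundaryVertex k i).1 + Pi.single (k + 1) 1) -
    G ((boundaryVertex k i).1 + Pi.single (k + 2) 1)

/-- Move the vertices of a honeycomb by the slopes of a function on the lattice points. -/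
def Honeycomb.addSlope {n : ℕ} (h : Honeycomb n) (G : (Fin 3 → ℕ) → ℝ)
    (hG : ∀ d k, 0 ≤ h.length d k + rhombus G d.1 k) : Honeycomb n where
  up u k := h.up u k + (G (u.1 + Pi.single (k + 1) 1) - G (u.1 + Pi.single (k + 2) 1))
  down d k := h.down d k + (G (d.1 + (Pi.single k 1 + Pi.single (k + 1) 1)) -
    G (d.1 + (Pi.single k 1 + Pi.single (k + 2) 1)))
  up_sum u := by
    rw [← h.up_sum u]
    simp only [Fin.isValue, Fin.reduceAdd]
    ring
  down_sum d := by
    rw [← h.down_sum d]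
    simp only [Fin.isValue, Fin.reduceAdd, add_comm (Pi.single 1 1) (Pi.single 0 1 : Fin 3 → ℕ),
      add_comm (Pi.single 2 1) (Pi.single 0 1 : Fin 3 → ℕ),
      add_comm (Pi.single 2 1) (Pi.single 1 1 : Fin 3 → ℕ)]
    ring
  edge k u d e := by
    obtain rfl : u = d.nbr k := Subtype.ext e
    refine ⟨_, hG d k, ?_⟩
    have hd := h.down_eq d k
    have h0 := congrFun hd k
    have h1 := congrFun hd (k + 1)
    have h2 := congrFun hd (k + 2)
    simp only [Pi.add_apply, Pi.smul_apply, edgeDir_self, edgeDir_add_one, edgeDir_add_two,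
      smul_eq_mul] at h0 h1 h2
    apply ext_fin_three k <;>
    · simp only [Pi.add_apply, Pi.smul_apply, edgeDir_self, edgeDir_add_one, edgeDir_add_two,
        smul_eq_mul, add_one_add_one, add_one_add_two, add_two_add_one,
        add_two_add_two, h0, h1, h2, rhombus, DownVertex.nbr, add_assoc d.1,
        add_comm (Pi.single (k + 1) 1) (Pi.single k 1 : Fin 3 → ℕ),
        add_comm (Pi.single (k + 2) 1) (Pi.single k 1 : Fin 3 → ℕ),
        add_comm (Pi.single (k + 2) 1) (Pi.single (k + 1) 1 : Fin 3 → ℕ)]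
      ring

theorem Honeycomb.length_addSlope {n : ℕ} (h : Honeycomb n) (G : (Fin 3 → ℕ) → ℝ)
    (hG : ∀ d k, 0 ≤ h.length d k + rhombus G d.1 k) (d : DownVertex n) (k : Fin 3) :
    (h.addSlope G hG).length d k = h.length d k + rhombus G d.1 k := by
  simp only [length, addSlope, rhombus, DownVertex.nbr, add_one_add_one, add_one_add_two, add_assoc d.1,
    add_comm (Pi.single (k + 1) 1) (Pi.single k 1 : Fin 3 → ℕ)]
  ring

theorem Honeycomb.boundary_addSlope {n : ℕ} (h : Honeycomb n) (G : (Fin 3 → ℕ) → ℝ)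
    (hG : ∀ d k, 0 ≤ h.length d k + rhombus G d.1 k) :
    (h.addSlope G hG).boundary = h.boundary + boundaryDiff n G := rfl

/-! ### Chamber functionals as edge lengths. -/

/-- The upside-down triangle between the `i`-th and the next upright triangle along side `k`. -/
def chamberTriangle {n : ℕ} (k : Fin 3) (i j : Fin n) (hij : (j : ℕ) = i + 1) : DownVertex n :=
  ⟨Pi.single (k + 1) (n - 2 - (i : ℕ)) + Pi.single (k + 2) (i : ℕ), by
    have := j.isLt
    fin_cases k <;> simp <;> omega⟩

theorem chamberTriangle_apply_self {n : ℕ} (k : Fin 3) (i j : Fin n) (hij : (j : ℕ) = i + 1) :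
    (chamberTriangle k i j hij).1 k = 0 := by
  fin_cases k <;> simp [chamberTriangle]

theorem nbr_chamberTriangle_left {n : ℕ} (k : Fin 3) (i j : Fin n) (hij : (j : ℕ) = i + 1) :
    (chamberTriangle k i j hij).nbr (k + 1) = boundaryVertex k i := by
  have := j.isLt
  apply Subtype.ext
  funext m
  fin_cases k <;> fin_cases m <;> simp [DownVertex.nbr, chamberTriangle, boundaryVertex] <;> omega

theorem nbr_chamberTriangle_right {n : ℕ} (k : Fin 3) (i j : Fin n) (hij : (j : ℕ) = i + 1) :
    (chamberTriangle k i j hij).nbr (k + 2) = boundaryVertex k j := by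
  have := j.isLt
  apply Subtype.ext
  funext m
  fin_cases k <;> fin_cases m <;> simp [DownVertex.nbr, chamberTriangle, boundaryVertex] <;> omega

/-- On the path from one boundary vertex to the next through the triangle between them, the `k`-th
coordinate drops by the full length of each of the two edges. -/
theorem Honeycomb.chamber_boundary {n : ℕ} (h : Honeycomb n) (k : Fin 3) (i j : Fin n)
    (hij : (j : ℕ) = i + 1) :
    chamber k i j h.boundary = h.length (chamberTriangle k i j hij) (k + 1) +
      h.length (chamberTriangle k i j hij) (k + 2) := by
  have e1 : edgeDir (k + 1) k = -1 := by fin_cases k <;> simp [edgeDir]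
  have e2 : edgeDir (k + 2) k = 1 := by fin_cases k <;> simp [edgeDir]
  have h1 := congrFun (h.down_eq (chamberTriangle k i j hij) (k + 1)) k
  have h2 := congrFun (h.down_eq (chamberTriangle k i j hij) (k + 2)) k
  rw [nbr_chamberTriangle_left] at h1
  rw [nbr_chamberTriangle_right] at h2
  simp only [Pi.add_apply, Pi.smul_apply, smul_eq_mul, e1, e2] at h1 h2
  simp only [chamber, LinearMap.coe_mk, AddHom.coe_mk, boundary]
  linarith

/-! ### Test functions: a convex quadratic and point indicators. -/

/-- Its slopes form the honeycomb all of whose edges have length one. -/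
noncomputable def quad (p : Fin 3 → ℕ) : ℝ := ∑ m, (p m : ℝ) ^ 2 / 2

theorem rhombus_quad (q : Fin 3 → ℕ) (k : Fin 3) : rhombus quad q k = 1 := by
  fin_cases k <;> simp [rhombus, quad, Fin.sum_univ_three] <;> ring

/-- The indicator function of a lattice point. -/
def bump (B p : Fin 3 → ℕ) : ℝ := if p = B then 1 else 0

theorem bump_nonneg (B p : Fin 3 → ℕ) : 0 ≤ bump B p := by
  unfold bump
  split_ifs <;> norm_num

theorem bump_le_one (B p : Fin 3 → ℕ) : bump B p ≤ 1 := by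
  unfold bump
  split_ifs <;> norm_num

theorem bump_add_left (q r s : Fin 3 → ℕ) : bump (q + r) (q + s) = if s = r then 1 else 0 := by
  simp [bump]

theorem abs_rhombus_bump_le (B q : Fin 3 → ℕ) (k : Fin 3) : |rhombus (bump B) q k| ≤ 2 := by
  have h0 := bump_nonneg B
  have h1 := bump_le_one B
  rw [abs_le, rhombus]
  constructor <;>
  linarith [h0 (q + (Pi.single (k + 1) 1 + Pi.single (k + 2) 1)),
    h0 (q + (Pi.single k 1 + Pi.single k 1)), h0 (q + (Pi.single k 1 + Pi.single (k + 1) 1)),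
    h0 (q + (Pi.single k 1 + Pi.single (k + 2) 1)),
    h1 (q + (Pi.single (k + 1) 1 + Pi.single (k + 2) 1)),
    h1 (q + (Pi.single k 1 + Pi.single k 1)), h1 (q + (Pi.single k 1 + Pi.single (k + 1) 1)),
    h1 (q + (Pi.single k 1 + Pi.single (k + 2) 1))]

/-- The slopes of the indicator of a point on side `k` shorten only the two edges at that point. -/
theorem rhombus_bump_nonneg {q₀ : Fin 3 → ℕ} {k₀ : Fin 3} (hq₀ : q₀ k₀ = 0) {q : Fin 3 → ℕ}
    {k : Fin 3} (h : ¬(q = q₀ ∧ (k = k₀ + 1 ∨ k = k₀ + 2))) :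
    0 ≤ rhombus (bump (q₀ + (Pi.single (k₀ + 1) 1 + Pi.single (k₀ + 2) 1))) q k := by
  have key : ∀ l, l = k + 1 ∨ l = k + 2 →
      bump (q₀ + (Pi.single (k₀ + 1) 1 + Pi.single (k₀ + 2) 1))
        (q + (Pi.single k 1 + Pi.single l 1)) = 0 := by
    intro l hl
    refine if_neg fun e => h ?_
    have e0 := congrFun e k₀
    -- The bump point lies on side `k₀`, so by `e0` neither raised index is `k₀`; they are the other
    -- two, which forces `q = q₀`.
    have hs : ∀ a b c : Fin 3, b = a + 1 ∨ b = a + 2 → c ≠ a → c ≠ b →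
        (c + 1 = a ∧ c + 2 = b ∨ c + 2 = a ∧ c + 1 = b) := by decide
    have hk : k₀ ≠ k := by
      rintro rfl
      fin_cases k₀ <;> simp at e0 <;> simp_all
    have hl' : k₀ ≠ l := by
      rintro rfl
      fin_cases k₀ <;> simp at e0 <;> simp_all
    rcases hs k l k₀ hl hk hl' with ⟨rfl, rfl⟩ | ⟨rfl, rfl⟩
    · exact ⟨add_right_cancel e, Or.inl rfl⟩
    · rw [add_comm (Pi.single (k₀ + 2) 1)] at e
      exact ⟨add_right_cancel e, Or.inr rfl⟩
  rw [rhombus, key _ (Or.inl rfl), key _ (Or.inr rfl), sub_zero, sub_zero]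
  exact add_nonneg (bump_nonneg _ _) (bump_nonneg _ _)

/-- A second difference is negative at the ends of the shared lattice segment and positive at the
two opposite corners. This point is an end of both segments. -/
theorem rhombus_bump_chamber (q : Fin 3 → ℕ) (k : Fin 3) :
    rhombus (bump (q + (Pi.single (k + 1) 1 + Pi.single (k + 2) 1))) q (k + 1) = -1 ∧
    rhombus (bump (q + (Pi.single (k + 1) 1 + Pi.single (k + 2) 1))) q (k + 2) = -1 := by
  simp only [rhombus, bump_add_left]
  fin_cases k <;> simp [funext_iff, Fin.forall_fin_succ, Pi.single_apply]

/-- This corner of the triangle is an end of one segment and opposite to the other, so the signs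
differ. -/
theorem rhombus_bump_inner_left (q : Fin 3 → ℕ) (k : Fin 3) :
    rhombus (bump (q + (Pi.single k 1 + Pi.single (k + 1) 1))) q (k + 1) = -1 ∧
    rhombus (bump (q + (Pi.single k 1 + Pi.single (k + 1) 1))) q (k + 2) = 1 := by
  simp only [rhombus, bump_add_left]
  fin_cases k <;> simp [funext_iff, Fin.forall_fin_succ, Pi.single_apply]

theorem rhombus_bump_inner_right (q : Fin 3 → ℕ) (k : Fin 3) :
    rhombus (bump (q + (Pi.single k 1 + Pi.single (k + 2) 1))) q (k + 1) = 1 ∧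
    rhombus (bump (q + (Pi.single k 1 + Pi.single (k + 2) 1))) q (k + 2) = -1 := by
  simp only [rhombus, bump_add_left]
  fin_cases k <;> simp [funext_iff, Fin.forall_fin_succ, Pi.single_apply]

/-- Boundary differences sample only points on the sides, where some coordinate vanishes. -/
theorem boundaryDiff_bump_eq_zero (n : ℕ) {X : Fin 3 → ℕ} (hX : ∀ m, X m ≠ 0) :
    boundaryDiff n (bump X) = 0 := by
  funext k i
  have h1 : (boundaryVertex k i).1 + Pi.single (k + 1) 1 ≠ X := by
    rintro rfl
    apply hX k
    fin_cases k <;> simp [boundaryVertex]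
  have h2 : (boundaryVertex k i).1 + Pi.single (k + 2) 1 ≠ X := by
    rintro rfl
    apply hX k
    fin_cases k <;> simp [boundaryVertex]
  simp [boundaryDiff, bump, h1, h2]

/-- For `n > 2` some interior lattice point lies on exactly one of the two edges at a boundary
point. -/
theorem exists_interior_bump {n : ℕ} (hn : 2 < n) (k : Fin 3) (i j : Fin n)
    (hij : (j : ℕ) = i + 1) : ∃ (X : Fin 3 → ℕ) (s : ℝ), (∀ m, X m ≠ 0) ∧ s * s = 1 ∧
      rhombus (bump X) (chamberTriangle k i j hij).1 (k + 1) = -s ∧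
      rhombus (bump X) (chamberTriangle k i j hij).1 (k + 2) = s := by
  have := j.isLt
  -- Of the two corners off side `k`, the left one has `(k + 2)`-nd coordinate `i`, so it fails only
  -- for `i = 0`. Then the right one has `(k + 1)`-st coordinate `n - 2`, positive since `n > 2`.
  by_cases hi : (i : ℕ) = 0
  · refine ⟨_, -1, ?_, by norm_num, by
      simpa using (rhombus_bump_inner_right (chamberTriangle k i j hij).1 k).1,
      (rhombus_bump_inner_right (chamberTriangle k i j hij).1 k).2⟩
    intro m
    fin_cases k <;> fin_cases m <;> simp [chamberTriangle] <;> omega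
  · refine ⟨_, 1, ?_, by norm_num, (rhombus_bump_inner_left (chamberTriangle k i j hij).1 k).1,
      (rhombus_bump_inner_left (chamberTriangle k i j hij).1 k).2⟩
    intro m
    fin_cases k <;> fin_cases m <;> simp [chamberTriangle] <;> omega

theorem rhombus_add (G H : (Fin 3 → ℕ) → ℝ) (q : Fin 3 → ℕ) (k : Fin 3) :
    rhombus (G + H) q k = rhombus G q k + rhombus H q k := by
  simp only [rhombus, Pi.add_apply]
  ring

theorem rhombus_smul (r : ℝ) (G : (Fin 3 → ℕ) → ℝ) (q : Fin 3 → ℕ) (k : Fin 3) :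
    rhombus (r • G) q k = r * rhombus G q k := by
  simp only [rhombus, Pi.smul_apply, smul_eq_mul]
  ring

theorem boundaryDiff_add (n : ℕ) (G H : (Fin 3 → ℕ) → ℝ) :
    boundaryDiff n (G + H) = boundaryDiff n G + boundaryDiff n H := by
  funext k i
  simp only [boundaryDiff, Pi.add_apply]
  ring

theorem boundaryDiff_smul (n : ℕ) (r : ℝ) (G : (Fin 3 → ℕ) → ℝ) :
    boundaryDiff n (r • G) = r • boundaryDiff n G := by
  funext k i
  simp only [boundaryDiff, Pi.smul_apply, smul_eq_mul]
  ring

/-! ### Chamber inequalities for `n > 2`. -/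

theorem isEssential_chamber {n : ℕ} (hn : 2 < n) (k : Fin 3) (i j : Fin n)
    (hij : (j : ℕ) = i + 1) : IsEssential (chamber k i j) (LR n) := by
  set d₀ := chamberTriangle k i j hij with hd₀
  set β := bump (d₀.1 + (Pi.single (k + 1) 1 + Pi.single (k + 2) 1)) with hβ
  obtain ⟨X, s, hX, hs, hX1, hX2⟩ := exists_interior_bump hn k i j hij
  obtain ⟨hβ1, hβ2⟩ := rhombus_bump_chamber d₀.1 k
  rw [← hβ] at hβ1 hβ2
  rw [← hd₀] at hX1 hX2
  have hβ0 : ∀ d : DownVertex n, ∀ l, ¬(d.1 = d₀.1 ∧ (l = k + 1 ∨ l = k + 2)) →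
      0 ≤ rhombus β d.1 l := fun d l h =>
    rhombus_bump_nonneg (chamberTriangle_apply_self k i j hij) h
  have hunit : ∀ (d : DownVertex n) l, 0 ≤ (Honeycomb.zero n).length d l + rhombus quad d.1 l := by
    simp [rhombus_quad]
  -- From unit lengths, the boundary bump collapses exactly the two chosen edges and shortens no
  -- other.
  have hface : ∀ (d : DownVertex n) l,
      0 ≤ (Honeycomb.zero n).length d l + rhombus (quad + β) d.1 l := by
    intro d l
    rw [Honeycomb.length_zero, rhombus_add, rhombus_quad]
    by_cases h : d.1 = d₀.1 ∧ (l = k + 1 ∨ l = k + 2)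
    · obtain ⟨h, rfl | rfl⟩ := h <;> rw [h] <;> linarith
    · linarith [hβ0 d l h]
  have hface_mem : boundaryDiff n (quad + β) ∈ {b ∈ LR n | chamber k i j b = 0} := by
    have hb := (Honeycomb.zero n).boundary_addSlope _ hface
    rw [Honeycomb.boundary_zero, zero_add] at hb
    refine ⟨⟨_, hb⟩, ?_⟩
    rw [← hb, Honeycomb.chamber_boundary _ _ _ _ hij, Honeycomb.length_addSlope,
      Honeycomb.length_addSlope, ← hd₀]
    simp only [Honeycomb.length_zero, rhombus_add, rhombus_quad, hβ1, hβ2]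
    norm_num
  have hb := (Honeycomb.zero n).boundary_addSlope _ hunit
  rw [Honeycomb.boundary_zero, zero_add] at hb
  refine isEssential_of_forall_sub_smul_mem (x₀ := boundaryDiff n quad) (zero_mem_LR n) ?_
    ⟨_, hb⟩ ?_ ?_
  · rintro _ ⟨h, rfl⟩
    rw [h.chamber_boundary k i j hij]
    exact add_nonneg (h.length_nonneg _ _) (h.length_nonneg _ _)
  · rw [← hb, Honeycomb.chamber_boundary _ _ _ _ hij, Honeycomb.length_addSlope,
      Honeycomb.length_addSlope]
    simp only [Honeycomb.length_zero, rhombus_quad]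
    norm_num
  · rintro _ ⟨h, rfl⟩
    set T₁ := h.length d₀ (k + 1) with hT₁
    set T₂ := h.length d₀ (k + 2) with hT₂
    -- The boundary bump removes the mean `a` of the two lengths and the interior bump their
    -- half-difference. `M` dominates what both bumps can take from any other edge, since `quad + β`
    -- leaves the two chosen edges unchanged and lengthens the others by at least one.
    set a := (T₁ + T₂) / 2 with ha
    set c := s * (T₁ - T₂) / 2 with hc
    set M := 2 * |a| + 2 * |c| with hM
    have hsc : s * c = (T₁ - T₂) / 2 := by
      rw [hc, mul_div_assoc, ← mul_assoc, hs, one_mul]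
    set G := M • (quad + β) + a • β + c • bump X with hG
    have hR : ∀ q l, rhombus G q l =
        M * (1 + rhombus β q l) + a * rhombus β q l + c * rhombus (bump X) q l := by
      intro q l
      simp only [hG, rhombus_add, rhombus_smul, rhombus_quad]
    have h1 : h.length d₀ (k + 1) + rhombus G d₀.1 (k + 1) = 0 := by
      rw [hR, hβ1, hX1, ← hT₁]
      linarith
    have h2 : h.length d₀ (k + 2) + rhombus G d₀.1 (k + 2) = 0 := by
      rw [hR, hβ2, hX2, ← hT₂]
      linarith
    have hpos : ∀ d l, 0 ≤ h.length d l + rhombus G d.1 l := by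
      intro d l
      by_cases hdl : d.1 = d₀.1 ∧ (l = k + 1 ∨ l = k + 2)
      · obtain ⟨hd, hl⟩ := hdl
        obtain rfl : d = d₀ := Subtype.ext hd
        rcases hl with rfl | rfl
        exacts [h1.ge, h2.ge]
      · have hM0 : 0 ≤ M := by positivity
        have hl := h.length_nonneg d l
        have hB : |a * rhombus β d.1 l| ≤ 2 * |a| := by
          rw [abs_mul, mul_comm]
          exact mul_le_mul_of_nonneg_right (abs_rhombus_bump_le _ _ _) (abs_nonneg _)
        have hC : |c * rhombus (bump X) d.1 l| ≤ 2 * |c| := by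
          rw [abs_mul, mul_comm]
          exact mul_le_mul_of_nonneg_right (abs_rhombus_bump_le _ _ _) (abs_nonneg _)
        have hMβ := mul_nonneg hM0 (hβ0 d l hdl)
        rw [hR]
        linarith [(abs_le.1 hB).1, (abs_le.1 hC).1]
    have hmem : (h.addSlope G hpos).boundary ∈ {b ∈ LR n | chamber k i j b = 0} := by
      refine ⟨⟨_, rfl⟩, ?_⟩
      rw [Honeycomb.chamber_boundary _ _ _ _ hij, Honeycomb.length_addSlope,
        Honeycomb.length_addSlope, h1, h2, add_zero]
    refine ⟨a, ?_⟩
    -- The interior bump drops out, and the coefficient of `β` in `G` is `M + a`; only a multiple of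
    -- the boundary of `quad` remains.
    have hsub : h.boundary - a • boundaryDiff n quad =
        (h.addSlope G hpos).boundary - (M + a) • boundaryDiff n (quad + β) := by
      rw [Honeycomb.boundary_addSlope]
      simp only [hG, boundaryDiff_add, boundaryDiff_smul, boundaryDiff_bump_eq_zero n hX]
      module
    rw [hsub]
    exact Submodule.sub_mem _ (Submodule.subset_span hmem)
      (Submodule.smul_mem _ _ (Submodule.subset_span hface_mem))

/-! ### The case `n = 2`. -/

/-- The central vertex of a `2`-honeycomb. -/
def center : DownVertex 2 := ⟨0, rfl⟩

/-- On boundaries of `2`-honeycombs, the length of the edge with constant `k`-th coordinate. -/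
def edgeFunctional (k : Fin 3) : (Fin 3 → Fin 2 → ℝ) →ₗ[ℝ] ℝ where
  toFun b := b (k + 1) 0 + b (k + 2) 0 + b k 1
  map_add' b c := by simp only [Pi.add_apply]; ring
  map_smul' r b := by simp only [Pi.smul_apply, smul_eq_mul, RingHom.id_apply]; ring

/-- The boundary of the `2`-honeycomb with center `w` and edge lengths `t`. -/
def boundaryOfLengths (w t : Fin 3 → ℝ) : Fin 3 → Fin 2 → ℝ :=
  fun k => ![w k + t (k + 1), w k - t (k + 2)]

theorem Honeycomb.boundary_eq_boundaryOfLengths (h : Honeycomb 2) :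
    h.boundary = boundaryOfLengths (h.down center) (h.length center) := by
  funext k i
  have e1 : edgeDir (k + 1) k = -1 := by fin_cases k <;> simp [edgeDir]
  have e2 : edgeDir (k + 2) k = 1 := by fin_cases k <;> simp [edgeDir]
  have hc : center = chamberTriangle k (0 : Fin 2) 1 rfl := by
    apply Subtype.ext
    simp [center, chamberTriangle]
  have h1 := congrFun (h.down_eq center (k + 1)) k
  have h2 := congrFun (h.down_eq center (k + 2)) k
  have n1 := nbr_chamberTriangle_left k (0 : Fin 2) 1 rfl
  have n2 := nbr_chamberTriangle_right k (0 : Fin 2) 1 rfl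
  rw [← hc] at n1 n2
  rw [n1] at h1
  rw [n2] at h2
  simp only [Pi.add_apply, Pi.smul_apply, smul_eq_mul, e1, e2] at h1 h2
  fin_cases i
  · simp only [boundary, boundaryOfLengths, Fin.zero_eta, Matrix.cons_val_zero]
    linarith
  · simp only [boundary, boundaryOfLengths, Fin.mk_one, Matrix.cons_val_one, Matrix.cons_val_fin_one]
    linarith

theorem boundaryOfLengths_mem_LR {w t : Fin 3 → ℝ} (hw : w 0 + w 1 + w 2 = 0)
    (ht : ∀ k, 0 ≤ t k) : boundaryOfLengths w t ∈ LR 2 := by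
  let h : Honeycomb 2 :=
    -- For `n = 2` the index `u` is a unit vector, so the sum selects a single edge leaving the
    -- center.
    { up := fun u => w - ∑ m, (u.1 m * t m : ℝ) • edgeDir m
      down := fun _ => w
      up_sum := fun u => by
        rw [← hw]
        simp [Fin.sum_univ_three, edgeDir]
        ring
      down_sum := fun _ => hw
      edge := fun k u d e => by
        have hd : d.1 = 0 := by
          have := d.2
          funext m
          fin_cases m <;> simp <;> omega
        refine ⟨t k, ht k, ?_⟩
        rw [e, hd]
        fin_cases k <;> simp [Fin.sum_univ_three] }
  refine ⟨h, ?_⟩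
  funext k i
  fin_cases k <;> fin_cases i <;>
    simp [h, Honeycomb.boundary, boundaryVertex, boundaryOfLengths, Fin.sum_univ_three, edgeDir]

/-- The center contributes `w 0 + w 1 + w 2 = 0`, and the two occurrences of `t (k + 2)` cancel. -/
theorem edgeFunctional_boundaryOfLengths {w : Fin 3 → ℝ} (hw : w 0 + w 1 + w 2 = 0)
    (t : Fin 3 → ℝ) (k : Fin 3) : edgeFunctional k (boundaryOfLengths w t) = t k := by
  fin_cases k <;> simp [edgeFunctional, boundaryOfLengths] <;> linarith

theorem isEssential_edgeFunctional (k : Fin 3) : IsEssential (edgeFunctional k) (LR 2) := by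
  have hmem : boundaryOfLengths 0 (Pi.single k 1) ∈ LR 2 :=
    boundaryOfLengths_mem_LR (by simp) fun l => by
      rw [Pi.single_apply]
      split_ifs <;> norm_num
  refine isEssential_of_forall_sub_smul_mem (zero_mem_LR 2) ?_ hmem ?_ ?_
  · rintro _ ⟨h, rfl⟩
    rw [h.boundary_eq_boundaryOfLengths, edgeFunctional_boundaryOfLengths (h.down_sum _)]
    exact h.length_nonneg _ _
  · rw [edgeFunctional_boundaryOfLengths (by simp)]
    simp
  · rintro _ ⟨h, rfl⟩
    refine ⟨h.length center k, Submodule.subset_span ?_⟩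
    -- Collapsing the edge `k` with the center fixed subtracts a multiple of one fixed ray and lands
    -- on the face.
    have e : h.boundary - h.length center k • boundaryOfLengths 0 (Pi.single k 1) =
        boundaryOfLengths (h.down center) (Function.update (h.length center) k 0) := by
      rw [h.boundary_eq_boundaryOfLengths]
      funext l i
      fin_cases k <;> fin_cases l <;> fin_cases i <;> simp [boundaryOfLengths]
    rw [e]
    refine ⟨boundaryOfLengths_mem_LR (h.down_sum _) fun l => ?_, ?_⟩
    · rw [Function.update_apply]
      split_ifs
      exacts [le_rfl, h.length_nonneg _ _]
    · rw [edgeFunctional_boundaryOfLengths (h.down_sum _), Function.update_self]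

theorem isRegularInequality_edgeFunctional (k : Fin 3) :
    IsRegularInequality 2 (edgeFunctional k) := by
  obtain ⟨hpos, hfacet⟩ := isEssential_edgeFunctional k
  refine ⟨hpos, hfacet, fun l i j hij hF => ?_⟩
  -- With edge `k` collapsed and the other two of length one, every chamber functional is positive,
  -- since it sums two different lengths.
  have hmem : boundaryOfLengths 0 (1 - Pi.single k 1) ∈ {b ∈ LR 2 | edgeFunctional k b = 0} := by
    refine ⟨boundaryOfLengths_mem_LR (by simp) fun l => ?_, ?_⟩
    · rw [Pi.sub_apply, Pi.single_apply]
      split_ifs <;> norm_num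
    · rw [edgeFunctional_boundaryOfLengths (by simp)]
      simp
  rw [hF] at hmem
  obtain rfl : i = 0 := by omega
  obtain rfl : j = 1 := by omega
  have h := hmem.2
  have hl : l + 1 ≠ l + 2 := by
    fin_cases l <;> decide
  simp only [chamber, boundaryOfLengths, LinearMap.coe_mk, AddHom.coe_mk, Matrix.cons_val_zero,
    Matrix.cons_val_one, Matrix.cons_val_fin_one, Pi.zero_apply, Pi.sub_apply, Pi.one_apply,
    Pi.single_apply] at h
  split_ifs at h with h1 h2
  · exact hl (h1.trans h2.symm)
  all_goals norm_num at h

theorem mainTheorem10 :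
    (∀ n : ℕ, 2 < n → ∀ (k : Fin 3) (i j : Fin n), (j : ℕ) = i + 1 →
      IsEssential (chamber k i j) (LR n)) ∧
    (∀ b : Fin 3 → Fin 2 → ℝ,
      (∀ f : (Fin 3 → Fin 2 → ℝ) →ₗ[ℝ] ℝ, IsRegularInequality 2 f → 0 ≤ f b) →
      b 0 0 + b 0 1 + b 1 0 + b 1 1 + b 2 0 + b 2 1 = 0 →
      ∀ k : Fin 3, 0 ≤ chamber k (0 : Fin 2) 1 b) := by
  refine ⟨fun n hn k i j hij => isEssential_chamber hn k i j hij, fun b hb hsum k => ?_⟩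
  have h : ∀ k, 0 ≤ b (k + 1) 0 + b (k + 2) 0 + b k 1 := fun k =>
    hb _ (isRegularInequality_edgeFunctional k)
  have h0 := h 0
  have h1 := h 1
  have h2 := h 2
  simp only [Fin.isValue, Fin.reduceAdd] at h0 h1 h2
  -- The chamber functional is the sum of the other two edge functionals minus the vanishing total.
  fin_cases k <;> simp [chamber] <;> linarith
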